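/- **Conventions.** Rings are associative with $1$. A $Z$-algebra, for a commutative ring $Z$, is a ring $R$ containing $Z$ as a subring of its centre. An ordered group $(G,<)$ is a (not necessarily abelian) group, written additively, with a strict total order invariant under left and right translations; $G_\infty=G\cup\{\infty\}$ with $g<\infty$ and $g+\infty=\infty+g=\infty+\infty=\infty$ for all $g\in G$. Put $|g|=\max\{g,-g\}$. For $g,h\in G$ write $g\ll h$ (equivalently $h\gg g$) if $n|g|<|h|$ for all integers $n\ge 1$, and $g\sim h$ if there are integers $m,n\ge 1$ with $|g|<m|h|$ and $|h|<n|g|$. These relations are only between elements of $G$, never involving $\infty$. A positive filtration on a $Z$-algebra $R$ (over $Z$, with values in $G$) is a map $\upsilon\colon R\to G_\infty$ such that for all $x,y\in R$ and $a\in Z$: $\upsilon(x)=\infty$ if and only if $x=0$; $\upsilon(x+y)\ge\min\{\upsilon(x),\upsilon(y)\}$; $\upsilon(xy)\ge\upsilon(x)+\upsilon(y)$; $\upsilon(a)\ge 0$. For $g\in G$ let $R_{\ge g}=\{x\in R:\upsilon(x)\ge g\}$, $R_{>g}=\{x\in R:\upsilon(x)>g\}$ and $R_g=R_{\ge g}/R_{>g}$.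 The associated graded ring is $\operatorname{gr}_\upsilon(R)=\bigoplus_{g\in G}R_g$ with multiplication $(x+R_{>g})(y+R_{>h})=xy+R_{>g+h}$. It contains $\operatorname{gr}_\upsilon(Z)$, the associated graded ring of the restriction of $\upsilon$ to $Z$, as a subring. For a ring $S$, the free $S$-ring on a set $Y$ is the monoid ring over $S$ of the free monoid on $Y$ (so the elements of $S$ commute with the elements of $Y$). The free group $Z$-algebra on $Y$ is the group algebra over $Z$ of the free group on $Y$. To say that a generated subring or subalgebra is one of these on $Y$ means that it is isomorphic to it by an isomorphism that is the identity on the coefficients and on $Y$. **Theorem.** Let $Z$ be a commutative ring, $R$ a $Z$-algebra, $(G,<)$ an ordered group and $\upsilon\colon R\to G_\infty$ a positive filtration over $Z$. Let $X$ be a subset of $R$ satisfying the following conditions. 1. The map $X\to\operatorname{gr}_\upsilon(R)$, $x\mapsto x+R_{>\upsilon(x)}$, is injective. 2. $\upsilon(x)>0$ for each $x\in X$. 3. $\upsilon(x)\sim\upsilon(y)$ for all $x,y\in X$ (in particular, $0\notin X$). 4. There is no $z\in Z$, $z\ne 0$, such that $\upsilon(z)\gg\upsilon(x)$ for some (and hence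 all) $x\in X$. 5. The subring of $\operatorname{gr}_\upsilon(R)$ generated by $\operatorname{gr}_\upsilon(Z)$ and $\{x+R_{>\upsilon(x)}\}_{x\in X}$ is the free $\operatorname{gr}_\upsilon(Z)$-ring on the set $\{x+R_{>\upsilon(x)}\}_{x\in X}$. 6. For each $x\in X$, $1+x$ is invertible in $R$ and $\upsilon((1+x)^{-1})\ll\upsilon(x)$. Then the $Z$-subalgebra of $R$ generated by $\{1+x,\,(1+x)^{-1}\}_{x\in X}$ is the free group $Z$-algebra on the set $\{1+x\}_{x\in X}$. -/

import Mathlib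

open scoped DirectSum

noncomputable section

/-! ### Comparing elements of an ordered group

An ordered group is an additively written, not necessarily commutative, group with a translation
invariant linear order: `[AddGroup G] [LinearOrder G] [AddLeftMono G] [AddRightMono G]`. In a group
the invariance of `≤` is equivalent to that of `<`. The set `G ∪ {∞}` is `WithTop G`. -/

section OrderedGroup

variable {G : Type*} [AddGroup G] [LinearOrder G]

/-- `g ≪ h`: `g` is infinitely small relative to `h`, that is, `n|g| < |h|` for all `n ≥ 1`. -/
def InfSmall (g h : G) : Prop :=
  ∀ n : ℕ, 0 < n → n • |g| < |h|

/-- `g ∼ h`: `g` and `h` are Archimedean equivalent. -/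
def ArchEquiv (g h : G) : Prop :=
  ∃ m n : ℕ, 0 < m ∧ 0 < n ∧ |g| < m • |h| ∧ |h| < n • |g|

/-- `a ≪ b` for values `a, b ∈ G ∪ {∞}`: both are finite, and they are so related in `G`. -/
def ValueInfSmall (a b : WithTop G) : Prop :=
  ∃ g h : G, a = g ∧ b = h ∧ InfSmall g h

/-- `a ∼ b` for values `a, b ∈ G ∪ {∞}`: both are finite, and they are so related in `G`. -/
def ValueArchEquiv (a b : WithTop G) : Prop :=
  ∃ g h : G, a = g ∧ b = h ∧ ArchEquiv g h

end OrderedGroup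

/-! ### Positive filtrations -/

/-- A positive filtration (over `Z`) on the `Z`-algebra `R` with values in `G`. -/
structure PositiveFiltration (Z R G : Type*) [CommRing Z] [Ring R] [Algebra Z R]
    [AddGroup G] [LinearOrder G] where
  toFun : R → WithTop G
  eq_top_iff' : ∀ x, toFun x = ⊤ ↔ x = 0
  min_le_add' : ∀ x y, min (toFun x) (toFun y) ≤ toFun (x + y)
  add_le_mul' : ∀ x y, toFun x + toFun y ≤ toFun (x * y)
  nonneg' : ∀ a : Z, 0 ≤ toFun (algebraMap Z R a)

namespace PositiveFiltration

variable {Z R G : Type*} [CommRing Z] [Ring R] [Algebra Z R] [AddGroup G] [LinearOrder G]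

instance : CoeFun (PositiveFiltration Z R G) (fun _ => R → WithTop G) := ⟨toFun⟩

/-- The restriction of a positive filtration to the ring of coefficients `Z ⊆ R`. -/
def restrict [FaithfulSMul Z R] (v : PositiveFiltration Z R G) : PositiveFiltration Z Z G where
  toFun a := v (algebraMap Z R a)
  eq_top_iff' a := by
    rw [v.eq_top_iff', FaithfulSMul.algebraMap_eq_zero_iff]
  min_le_add' a b := by rw [map_add]; exact v.min_le_add' _ _
  add_le_mul' a b := by rw [map_mul]; exact v.add_le_mul' _ _
  nonneg' a := v.nonneg' a

variable (v : PositiveFiltration Z R G)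

theorem apply_zero : v 0 = ⊤ := (v.eq_top_iff' 0).2 rfl

theorem one_nonneg' : 0 ≤ v 1 := by
  simpa using v.nonneg' 1

theorem mul_mem_ge [AddLeftMono G] [AddRightMono G] {g h : G} {x y : R}
    (hx : (g : WithTop G) ≤ v x) (hy : (h : WithTop G) ≤ v y) :
    ((g + h : G) : WithTop G) ≤ v (x * y) := by
  rw [WithTop.coe_add]
  exact (add_le_add hx hy).trans (v.add_le_mul' x y)

theorem mul_mem_gt_left [AddLeftMono G] [AddRightMono G] {g h : G} {x y : R}
    (hx : (g : WithTop G) < v x) (hy : (h : WithTop G) ≤ v y) :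
    ((g + h : G) : WithTop G) < v (x * y) := by
  refine lt_of_lt_of_le ?_ (v.add_le_mul' x y)
  revert hx hy
  generalize v x = a
  generalize v y = b
  induction a with
  | top => intro _ _; simp
  | coe a =>
    induction b with
    | top => intro _ _; simp
    | coe b =>
      intro hx hy
      norm_cast at hx hy ⊢
      exact add_lt_add_of_lt_of_le hx hy

theorem mul_mem_gt_right [AddLeftMono G] [AddRightMono G] {g h : G} {x y : R}
    (hx : (g : WithTop G) ≤ v x) (hy : (h : WithTop G) < v y) :
    ((g + h : G) : WithTop G) < v (x * y) := by
  refine lt_of_lt_of_le ?_ (v.add_le_mul' x y)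
  revert hx hy
  generalize v x = a
  generalize v y = b
  induction a with
  | top => intro _ _; simp
  | coe a =>
    induction b with
    | top => intro _ _; simp
    | coe b =>
      intro hx hy
      norm_cast at hx hy ⊢
      exact add_lt_add_of_le_of_lt hx hy

variable [AddLeftMono G]

theorem le_apply_neg (x : R) : v x ≤ v (-x) := by
  have h1 : 0 ≤ v (-1) := by simpa using v.nonneg' (-1)
  have h2 := v.add_le_mul' x (-1)
  rw [mul_neg_one] at h2
  exact (le_add_of_nonneg_right h1).trans h2

/-- `R_{≥ g}` -/
def ge (g : G) : AddSubgroup R where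
  carrier := {x | (g : WithTop G) ≤ v x}
  add_mem' {x y} hx hy := (le_min hx hy).trans (v.min_le_add' x y)
  zero_mem' := by simp [v.apply_zero]
  neg_mem' {x} hx := le_trans hx (v.le_apply_neg x)

/-- `R_{> g}` -/
def gt (g : G) : AddSubgroup R where
  carrier := {x | (g : WithTop G) < v x}
  add_mem' {x y} hx hy := (lt_min hx hy).trans_le (v.min_le_add' x y)
  zero_mem' := by simp [v.apply_zero]
  neg_mem' {x} hx := lt_of_lt_of_le hx (v.le_apply_neg x)

theorem mem_ge {g : G} {x : R} : x ∈ v.ge g ↔ (g : WithTop G) ≤ v x := Iff.rfl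

theorem mem_gt {g : G} {x : R} : x ∈ v.gt g ↔ (g : WithTop G) < v x := Iff.rfl

/-- `R_g = R_{≥ g} / R_{> g}` -/
def Piece (g : G) : Type _ :=
  v.ge g ⧸ (v.gt g).addSubgroupOf (v.ge g)

instance (g : G) : AddCommGroup (v.Piece g) :=
  inferInstanceAs (AddCommGroup (v.ge g ⧸ (v.gt g).addSubgroupOf (v.ge g)))

/-- The class `x + R_{> g} ∈ R_g` of an element `x ∈ R_{≥ g}`. -/
def pieceMk (g : G) : v.ge g →+ v.Piece g :=
  QuotientAddGroup.mk' ((v.gt g).addSubgroupOf (v.ge g))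

theorem pieceMk_surjective (g : G) : Function.Surjective (v.pieceMk g) :=
  QuotientAddGroup.mk'_surjective _

theorem pieceMk_eq_zero_iff {g : G} (x : v.ge g) :
    v.pieceMk g x = 0 ↔ (g : WithTop G) < v (x : R) :=
  (QuotientAddGroup.eq_zero_iff x).trans AddSubgroup.mem_addSubgroupOf

theorem gradedMk_ext {g h : G} (hgh : g = h) {x : v.ge g} {y : v.ge h} (hxy : (x : R) = y) :
    GradedMonoid.mk (A := v.Piece) g (v.pieceMk g x) =
      GradedMonoid.mk (A := v.Piece) h (v.pieceMk h y) := by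
  subst hgh
  rw [Subtype.ext hxy]

/-- The inclusion `Z_{≥ g} → R_{≥ g}`. -/
def restrictGe [FaithfulSMul Z R] (g : G) : v.restrict.ge g →+ v.ge g :=
  AddMonoidHom.mk' (fun a => ⟨algebraMap Z R a, a.2⟩)
    (fun a b => Subtype.ext (map_add (algebraMap Z R) (a : Z) b))

/-- The map `Z_g → R_g`, `a + Z_{> g} ↦ a + R_{> g}`. -/
def restrictPiece [FaithfulSMul Z R] (g : G) : v.restrict.Piece g →+ v.Piece g :=
  QuotientAddGroup.lift _ ((v.pieceMk g).comp (v.restrictGe g))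
    (fun a ha => (v.pieceMk_eq_zero_iff (v.restrictGe g a)).2
      (show (g : WithTop G) < v (algebraMap Z R a) from AddSubgroup.mem_addSubgroupOf.1 ha))

theorem restrictPiece_mk [FaithfulSMul Z R] {g : G} (a : v.restrict.ge g) :
    v.restrictPiece g (v.restrict.pieceMk g a) = v.pieceMk g (v.restrictGe g a) := rfl

variable [AddRightMono G]

/-- The multiplication `R_{≥ g} × R_{≥ h} → R_{≥ g + h}`. -/
def geMul (g h : G) : v.ge g →+ v.ge h →+ v.ge (g + h) :=
  AddMonoidHom.mk' (fun x => AddMonoidHom.mk' (fun y => ⟨x * y, v.mem_ge.2 (v.mul_mem_ge x.2 y.2)⟩)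
    (fun y z => Subtype.ext (mul_add (x : R) y z)))
    (fun x y => AddMonoidHom.ext fun z => Subtype.ext (add_mul (x : R) y z))

/-- The multiplication `R_g × R_h → R_{g + h}`,
`(x + R_{> g}) (y + R_{> h}) = x y + R_{> g + h}`. -/
def pieceMul (g h : G) : v.Piece g →+ v.Piece h →+ v.Piece (g + h) :=
  QuotientAddGroup.lift _
    (AddMonoidHom.mk' (fun x => QuotientAddGroup.lift _
        ((v.pieceMk (g + h)).comp (v.geMul g h x))
        (fun y hy => (v.pieceMk_eq_zero_iff _).2
          (v.mul_mem_gt_right x.2 (AddSubgroup.mem_addSubgroupOf.1 hy))))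
      (fun x y => by
        refine AddMonoidHom.ext fun z => ?_
        obtain ⟨z, rfl⟩ := v.pieceMk_surjective h z
        change v.pieceMk (g + h) (v.geMul g h (x + y) z) =
          v.pieceMk (g + h) (v.geMul g h x z) + v.pieceMk (g + h) (v.geMul g h y z)
        simp))
    (fun x hx => by
      refine AddMonoidHom.ext fun z => ?_
      obtain ⟨z, rfl⟩ := v.pieceMk_surjective h z
      exact (v.pieceMk_eq_zero_iff _).2
        (v.mul_mem_gt_left (AddSubgroup.mem_addSubgroupOf.1 hx) z.2))

theorem pieceMul_mk {g h : G} (x : v.ge g) (y : v.ge h) :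
    v.pieceMul g h (v.pieceMk g x) (v.pieceMk h y) =
      v.pieceMk (g + h) ⟨x * y, v.mem_ge.2 (v.mul_mem_ge x.2 y.2)⟩ := rfl

instance : GradedMonoid.GMul v.Piece where
  mul {g h} x y := v.pieceMul g h x y

instance : GradedMonoid.GOne v.Piece where
  one := v.pieceMk 0 ⟨1, v.mem_ge.2 v.one_nonneg'⟩

instance : DirectSum.GRing v.Piece where
  mul_zero {g h} x := (v.pieceMul g h x).map_zero
  zero_mul {g h} y := by
    change v.pieceMul g h 0 y = 0
    rw [(v.pieceMul g h).map_zero]; rfl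
  mul_add {g h} x y z := (v.pieceMul g h x).map_add y z
  add_mul {g h} x y z := by
    change v.pieceMul g h (x + y) z = v.pieceMul g h x z + v.pieceMul g h y z
    rw [(v.pieceMul g h).map_add]; rfl
  one_mul a := by
    obtain ⟨g, x⟩ := a
    obtain ⟨x, rfl⟩ := v.pieceMk_surjective g x
    exact v.gradedMk_ext (zero_add g) (one_mul (x : R))
  mul_one a := by
    obtain ⟨g, x⟩ := a
    obtain ⟨x, rfl⟩ := v.pieceMk_surjective g x
    exact v.gradedMk_ext (add_zero g) (mul_one (x : R))
  mul_assoc a b c := by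
    obtain ⟨g, x⟩ := a
    obtain ⟨h, y⟩ := b
    obtain ⟨k, z⟩ := c
    obtain ⟨x, rfl⟩ := v.pieceMk_surjective g x
    obtain ⟨y, rfl⟩ := v.pieceMk_surjective h y
    obtain ⟨z, rfl⟩ := v.pieceMk_surjective k z
    exact v.gradedMk_ext (add_assoc g h k) (mul_assoc (x : R) y z)
  natCast n := n • v.pieceMk 0 ⟨1, v.mem_ge.2 v.one_nonneg'⟩
  natCast_zero := zero_nsmul _
  natCast_succ n := succ_nsmul _ n
  intCast n := n • v.pieceMk 0 ⟨1, v.mem_ge.2 v.one_nonneg'⟩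
  intCast_ofNat n := natCast_zsmul _ n
  intCast_negSucc_ofNat n := negSucc_zsmul _ n

/-- The associated graded ring `gr_v(R) = ⨁_g R_g`. -/
abbrev Gr : Type _ := ⨁ g : G, v.Piece g

open Classical in
/-- The leading form `x + R_{> v(x)} ∈ R_{v(x)} ⊆ gr_v(R)` of a nonzero element `x` of `R`;
by convention it is `0` for `x = 0`. -/
def leadingForm (x : R) : v.Gr :=
  if hx : v x = ⊤ then 0
  else DirectSum.of v.Piece ((v x).untop hx)
    (v.pieceMk _ ⟨x, v.mem_ge.2 (WithTop.coe_untop (v x) hx).le⟩)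

/-- The inclusion of graded rings `gr_v(Z) ⊆ gr_v(R)`, where `Z` carries the restriction of `v`. -/
def grInclusion [FaithfulSMul Z R] : v.restrict.Gr →+* v.Gr :=
  DirectSum.toSemiring
    (fun g => (DirectSum.of v.Piece g).comp (v.restrictPiece g))
    (congrArg (DirectSum.of v.Piece 0)
      ((v.restrictPiece_mk _).trans
        (congrArg (v.pieceMk 0) (Subtype.ext (map_one (algebraMap Z R))))))
    (fun {g h} x y => by
      obtain ⟨x, rfl⟩ := v.restrict.pieceMk_surjective g x
      obtain ⟨y, rfl⟩ := v.restrict.pieceMk_surjective h y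
      refine Eq.trans ?_ (DirectSum.of_mul_of _ _).symm
      refine congrArg (DirectSum.of v.Piece (g + h)) ?_
      refine (v.restrictPiece_mk _).trans ?_
      exact congrArg (v.pieceMk (g + h)) (Subtype.ext (map_mul (algebraMap Z R) (x : Z) y)))

end PositiveFiltration

/-! ### Free rings and free group algebras inside a ring -/

/-- Let `i : S →+* A` be an inclusion of (possibly noncommutative) rings and `Y ⊆ A`. This says that
the subring of `A` generated by `S` and `Y` is the free `S`-ring on `Y`: it is isomorphic to
the monoid ring of the free monoid on `Y` with coefficients in `S` (so that coefficients commute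
with the variables), by an isomorphism which is the identity on `S` and on `Y`. -/
def GeneratesFreeRing {S A : Type*} [Ring S] [Ring A] (i : S →+* A) (Y : Set A) : Prop :=
  ∃ e : MonoidAlgebra S (FreeMonoid Y) ≃+* Subring.closure (Set.range i ∪ Y),
    (∀ s : S, (e (MonoidAlgebra.single 1 s) : A) = i s) ∧
    (∀ y : Y, (e (MonoidAlgebra.single (FreeMonoid.of y) 1) : A) = y)

/-- For a set `Y` of units of the `Z`-algebra `A`, this says that the `Z`-subalgebra of `A`
generated by the elements of `Y` and their inverses is the free group `Z`-algebra on `Y`: it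
is isomorphic to the group algebra over `Z` of the free group on `Y`, by an isomorphism of
`Z`-algebras which is the identity on `Y`. -/
def GeneratesFreeGroupAlgebra (Z : Type*) {A : Type*} [CommRing Z] [Ring A] [Algebra Z A]
    (Y : Set A) : Prop :=
  (∀ y ∈ Y, IsUnit y) ∧
  ∃ e : MonoidAlgebra Z (FreeGroup Y) ≃ₐ[Z]
      Algebra.adjoin Z (Y ∪ {a : A | ∃ u : Aˣ, (u : A) ∈ Y ∧ a = (u⁻¹ : Aˣ)}),
    ∀ y : Y, (e (MonoidAlgebra.single (FreeGroup.of y) 1) : A) = y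

end

/-! Let `F` be the free group on the set of elements `1 + x`. What must be shown is that the
evaluation `Z[F] → R` is injective. The Magnus expansion `a = 1 + (a - 1)` writes an element of
`Z[F]` as a noncommutative power series in the variables `a - 1`. Such series need not converge in
`R`, so only truncations are used, with a remainder given by Fox derivatives. Iterating `f = ε(f) +
∑ (a - 1) ∂ₐf` up to `N` times leaves a remainder made of monomials of degree `N` times iterated
derivatives of `f`. Fox derivatives do not increase word length, so these derivatives stay in the
span of words of length at most `n`.

Suppose `f ≠ 0` maps to `0`. Some Magnus coefficient `c` of `f`, at a monomial `m`, is nonzero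
(`exists_magnusCoeff_ne_zero`). Let `γ > 0` be the least value of the finitely many `x` involved. By
condition 6 each letter or inverse letter has value at least `-γ`, so the remainder, and hence the
truncation, has value at least `(N - n)γ` (`exists_magnus_approx`). Since the leading forms are free
over `gr(Z)`, no cancellation can raise the value of a polynomial above that of any of its terms
(`apply_sum_le`). So the truncation has value at most `υ(c) + υ(x₁) + ⋯`, summed along `m`, and
conditions 3 and 4 bound this by a multiple of `γ` independent of `N`. A large `N` gives a
contradiction. -/

open scoped DirectSum

noncomputable section

/-! ### Fox derivatives on the group algebra of a free group -/

namespace FreeGroupAlgebra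

variable {Z α : Type*} [CommRing Z]

open Classical in
/-- The affine permutation of `Z[F] × Z[F]` attached to the generator `b`, whose translation part
records the Fox derivative in the direction `a`. -/
def foxPerm (a b : α) :
    Equiv.Perm (MonoidAlgebra Z (FreeGroup α) × MonoidAlgebra Z (FreeGroup α)) where
  toFun p := (p.1 + (if a = b then p.2 else 0), MonoidAlgebra.of Z _ (FreeGroup.of b) * p.2)
  invFun p := (p.1 - (if a = b then MonoidAlgebra.of Z _ (FreeGroup.of b)⁻¹ * p.2 else 0),
    MonoidAlgebra.of Z _ (FreeGroup.of b)⁻¹ * p.2)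
  left_inv p := by
    have h : MonoidAlgebra.of Z _ (FreeGroup.of b)⁻¹ *
        (MonoidAlgebra.of Z _ (FreeGroup.of b) * p.2) = p.2 := by
      rw [← mul_assoc, ← map_mul, inv_mul_cancel, map_one, one_mul]
    ext1 <;> simp only [h, add_sub_cancel_right]
  right_inv p := by
    have h : MonoidAlgebra.of Z _ (FreeGroup.of b) *
        (MonoidAlgebra.of Z _ (FreeGroup.of b)⁻¹ * p.2) = p.2 := by
      rw [← mul_assoc, ← map_mul, mul_inv_cancel, map_one, one_mul]
    ext1 <;> simp only [h, sub_add_cancel]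

/-- Together with the first coordinate this shows that `(0, 1)` is sent to `(∂g, g)`. The universal
property of the free group thus makes the derivative well defined with no check on reduced words. -/
theorem lift_foxPerm_snd (a : α) (g : FreeGroup α)
    (p : MonoidAlgebra Z (FreeGroup α) × MonoidAlgebra Z (FreeGroup α)) :
    (FreeGroup.lift (foxPerm a) g p).2 = MonoidAlgebra.of Z _ g * p.2 := by
  induction g using FreeGroup.induction_on generalizing p with
  | C1 => rw [map_one, map_one, one_mul]; rfl
  | of b => rw [FreeGroup.lift_apply_of]; rfl
  | inv_of b _ => rw [map_inv, FreeGroup.lift_apply_of]; rfl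
  | mul g h hg hh =>
    rw [map_mul, Equiv.Perm.mul_apply, hg, hh, map_mul, mul_assoc]

/-- The Fox derivative with respect to the generator `a` of a group element; it satisfies
`∂(g h) = ∂(g) h + ∂(h)`. -/
def foxCocycle (a : α) (g : FreeGroup α) : MonoidAlgebra Z (FreeGroup α) :=
  (FreeGroup.lift (foxPerm a) g (0, 1)).1

theorem foxCocycle_one (a : α) : foxCocycle (Z := Z) a 1 = 0 := by
  rw [foxCocycle, map_one]; rfl

open Classical in
theorem foxCocycle_of_mul (a b : α) (g : FreeGroup α) :
    foxCocycle (Z := Z) a (FreeGroup.of b * g) =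
      foxCocycle a g + if a = b then MonoidAlgebra.of Z _ g else 0 := by
  have h := lift_foxPerm_snd (Z := Z) a g (0, 1)
  rw [mul_one] at h
  rw [foxCocycle, map_mul, Equiv.Perm.mul_apply, FreeGroup.lift_apply_of, ← h]
  rfl

open Classical in
theorem foxCocycle_inv_of_mul (a b : α) (g : FreeGroup α) :
    foxCocycle (Z := Z) a ((FreeGroup.of b)⁻¹ * g) =
      foxCocycle a g -
        if a = b then MonoidAlgebra.of Z _ (FreeGroup.of b)⁻¹ * MonoidAlgebra.of Z _ g else 0 := by
  have h := lift_foxPerm_snd (Z := Z) a g (0, 1)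
  rw [mul_one] at h
  rw [foxCocycle, map_mul, Equiv.Perm.mul_apply, map_inv, FreeGroup.lift_apply_of, ← h]
  rfl

/-- The Fox derivative with respect to the generator `a`. -/
def foxDeriv (a : α) : MonoidAlgebra Z (FreeGroup α) →ₗ[Z] MonoidAlgebra Z (FreeGroup α) :=
  Finsupp.linearCombination Z (foxCocycle a) ∘ₗ
    (MonoidAlgebra.coeffLinearEquiv Z : MonoidAlgebra Z (FreeGroup α) ≃ₗ[Z] _).toLinearMap

theorem foxDeriv_of (a : α) (g : FreeGroup α) :
    foxDeriv a (MonoidAlgebra.of Z _ g) = foxCocycle a g := by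
  simp [foxDeriv]

/-- The augmentation of the group algebra. -/
def augmentation : MonoidAlgebra Z (FreeGroup α) →ₐ[Z] Z := MonoidAlgebra.lift Z Z _ 1

theorem augmentation_of (g : FreeGroup α) : augmentation (MonoidAlgebra.of Z _ g) = 1 := by
  rw [augmentation, MonoidAlgebra.lift_of]; rfl

/-! ### Word length and the filtration of the group algebra by it -/

/-- `IsWord T n g`: the element `g` is the product of at most `n` letters from `T` and inverses of
such. -/
inductive IsWord (T : Finset α) : ℕ → FreeGroup α → Prop
  | one (n : ℕ) : IsWord T n 1
  | of_mul {n : ℕ} {g : FreeGroup α} {b : α} (hb : b ∈ T) (hg : IsWord T n g) :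
      IsWord T (n + 1) (FreeGroup.of b * g)
  | inv_of_mul {n : ℕ} {g : FreeGroup α} {b : α} (hb : b ∈ T) (hg : IsWord T n g) :
      IsWord T (n + 1) ((FreeGroup.of b)⁻¹ * g)

theorem IsWord.mono {S T : Finset α} {m n : ℕ} {g : FreeGroup α} (h : IsWord S m g) (hST : S ⊆ T)
    (hmn : m ≤ n) : IsWord T n g := by
  induction h generalizing n with
  | one => exact .one n
  | of_mul hb _ ih =>
    obtain ⟨k, rfl⟩ := Nat.exists_eq_add_of_le' hmn
    exact .of_mul (hST hb) (ih (Nat.le_add_left _ _))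
  | inv_of_mul hb _ ih =>
    obtain ⟨k, rfl⟩ := Nat.exists_eq_add_of_le' hmn
    exact .inv_of_mul (hST hb) (ih (Nat.le_add_left _ _))

theorem IsWord.mul {T : Finset α} {m n : ℕ} {g h : FreeGroup α} (hg : IsWord T m g)
    (hh : IsWord T n h) : IsWord T (n + m) (g * h) := by
  induction hg with
  | one => rw [one_mul]; exact hh.mono subset_rfl (Nat.le_add_right _ _)
  | of_mul hb _ ih => rw [mul_assoc]; exact .of_mul hb ih
  | inv_of_mul hb _ ih => rw [mul_assoc]; exact .inv_of_mul hb ih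

open Classical in
theorem exists_isWord (g : FreeGroup α) : ∃ T n, IsWord T n g := by
  induction g using FreeGroup.induction_on with
  | C1 => exact ⟨∅, 0, .one 0⟩
  | of b => exact ⟨{b}, 1, by simpa using IsWord.of_mul (Finset.mem_singleton_self b) (.one 0)⟩
  | inv_of b _ =>
    exact ⟨{b}, 1, by simpa using IsWord.inv_of_mul (Finset.mem_singleton_self b) (.one 0)⟩
  | mul g h hg hh =>
    obtain ⟨S, m, hg⟩ := hg
    obtain ⟨T, n, hh⟩ := hh
    exact ⟨S ∪ T, n + m, (hg.mono Finset.subset_union_left le_rfl).mul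
      (hh.mono Finset.subset_union_right le_rfl)⟩

variable (Z) in
/-- The span of the group elements of length at most `n` in the letters from `T`. -/
def wordSpan (T : Finset α) (n : ℕ) : Submodule Z (MonoidAlgebra Z (FreeGroup α)) :=
  Submodule.span Z (MonoidAlgebra.of Z _ '' {g | IsWord T n g})

theorem of_mem_wordSpan {T : Finset α} {n : ℕ} {g : FreeGroup α} (h : IsWord T n g) :
    MonoidAlgebra.of Z _ g ∈ wordSpan Z T n :=
  Submodule.subset_span ⟨g, h, rfl⟩

theorem wordSpan_mono {S T : Finset α} {m n : ℕ} (hST : S ⊆ T) (hmn : m ≤ n) :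
    wordSpan Z S m ≤ wordSpan Z T n :=
  Submodule.span_mono (Set.image_mono fun _ h => h.mono hST hmn)

open Classical in
theorem exists_mem_wordSpan (f : MonoidAlgebra Z (FreeGroup α)) : ∃ T n, f ∈ wordSpan Z T n := by
  induction f using MonoidAlgebra.induction_on with
  | of g =>
    obtain ⟨T, n, h⟩ := exists_isWord g
    exact ⟨T, n, of_mem_wordSpan h⟩
  | add f g hf hg =>
    obtain ⟨S, m, hf⟩ := hf
    obtain ⟨T, n, hg⟩ := hg
    exact ⟨S ∪ T, m + n, add_mem
      (wordSpan_mono Finset.subset_union_left (Nat.le_add_right _ _) hf)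
      (wordSpan_mono Finset.subset_union_right (Nat.le_add_left _ _) hg)⟩
  | smul c f hf =>
    obtain ⟨T, n, hf⟩ := hf
    exact ⟨T, n, Submodule.smul_mem _ c hf⟩

variable (Z) in
/-- The span of the elements of length at most `n`, and of those of length at most `n + 1` which
begin with the inverse of the letter `a`. -/
def invWordSpan (T : Finset α) (a : α) (n : ℕ) : Submodule Z (MonoidAlgebra Z (FreeGroup α)) :=
  wordSpan Z T n ⊔ (wordSpan Z T n).map
    (LinearMap.mulLeft Z (MonoidAlgebra.of Z _ (FreeGroup.of a)⁻¹))

/-! ### Fox derivatives and word length -/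

theorem foxCocycle_mem {T : Finset α} {n : ℕ} {g : FreeGroup α} (hg : IsWord T n g) (a : α) :
    foxCocycle a g ∈ wordSpan Z T n := by
  classical
  induction hg with
  | one => rw [foxCocycle_one]; exact zero_mem _
  | of_mul hb hg ih =>
    rw [foxCocycle_of_mul]
    refine wordSpan_mono subset_rfl (Nat.le_succ _) (add_mem ih ?_)
    split_ifs
    exacts [of_mem_wordSpan hg, zero_mem _]
  | inv_of_mul hb hg ih =>
    rw [foxCocycle_inv_of_mul, ← map_mul]
    refine sub_mem (wordSpan_mono subset_rfl (Nat.le_succ _) ih) ?_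
    split_ifs
    exacts [of_mem_wordSpan (.inv_of_mul hb hg), zero_mem _]

theorem foxDeriv_mem {T : Finset α} {n : ℕ} {f : MonoidAlgebra Z (FreeGroup α)}
    (hf : f ∈ wordSpan Z T n) (a : α) : foxDeriv a f ∈ wordSpan Z T n := by
  refine (Submodule.span_le (p := (wordSpan Z T n).comap (foxDeriv a))).2 ?_ hf
  rintro _ ⟨g, hg, rfl⟩
  change foxDeriv a (MonoidAlgebra.of Z _ g) ∈ wordSpan Z T n
  rw [foxDeriv_of]
  exact foxCocycle_mem hg a

/-- Removing the first letter shortens every term of the derivative except the one coming from a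
word that starts with `a⁻¹`, since `∂ₐ(a⁻¹g) = ∂ₐg - a⁻¹g`. -/
theorem foxDeriv_mem_invWordSpan {T : Finset α} {n : ℕ} {f : MonoidAlgebra Z (FreeGroup α)}
    (hf : f ∈ wordSpan Z T (n + 1)) (a : α) : foxDeriv a f ∈ invWordSpan Z T a n := by
  classical
  refine (Submodule.span_le (p := (invWordSpan Z T a n).comap (foxDeriv a))).2 ?_ hf
  rintro _ ⟨g, hg, rfl⟩
  change foxDeriv a (MonoidAlgebra.of Z _ g) ∈ invWordSpan Z T a n
  rw [foxDeriv_of]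
  cases hg with
  | one => rw [foxCocycle_one]; exact zero_mem _
  | of_mul hb hg =>
    rw [foxCocycle_of_mul]
    refine Submodule.mem_sup_left (add_mem (foxCocycle_mem hg a) ?_)
    split_ifs
    exacts [of_mem_wordSpan hg, zero_mem _]
  | inv_of_mul hb hg =>
    rw [foxCocycle_inv_of_mul]
    refine sub_mem (Submodule.mem_sup_left (foxCocycle_mem hg a)) ?_
    split_ifs with hab
    · subst hab
      exact Submodule.mem_sup_right (Submodule.mem_map_of_mem (of_mem_wordSpan hg))
    · exact zero_mem _

open Classical in
theorem foxDeriv_inv_of_mul (a b : α) (f : MonoidAlgebra Z (FreeGroup α)) :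
    foxDeriv a (MonoidAlgebra.of Z _ (FreeGroup.of b)⁻¹ * f) =
      foxDeriv a f - if a = b then MonoidAlgebra.of Z _ (FreeGroup.of b)⁻¹ * f else 0 := by
  induction f using MonoidAlgebra.induction_on with
  | of g => rw [← map_mul, foxDeriv_of, foxDeriv_of, foxCocycle_inv_of_mul, map_mul]
  | add f g hf hg => rw [mul_add, map_add, hf, hg, map_add]; split_ifs <;> abel
  | smul c f hf => rw [mul_smul_comm, map_smul, hf, map_smul, smul_sub]; split_ifs <;> simp

/-- The long part `a⁻¹q` of `f` cancels against the term `-a⁻¹q` of `∂ₐ(a⁻¹q)`. This drop in length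
drives the induction proving that the Magnus expansion is injective. -/
theorem foxDeriv_self_add_mem {T : Finset α} {n : ℕ} {a : α} {f : MonoidAlgebra Z (FreeGroup α)}
    (hf : f ∈ invWordSpan Z T a n) : foxDeriv a f + f ∈ wordSpan Z T n := by
  obtain ⟨p, hp, _, ⟨q, hq, rfl⟩, rfl⟩ := Submodule.mem_sup.1 hf
  rw [LinearMap.mulLeft_apply, map_add, foxDeriv_inv_of_mul, if_pos rfl]
  have := add_mem (add_mem (foxDeriv_mem hp a) hp) (foxDeriv_mem hq a)
  convert this using 1
  abel

theorem foxDeriv_mem_of_ne {T : Finset α} {n : ℕ} {a b : α} (hab : b ≠ a)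
    {f : MonoidAlgebra Z (FreeGroup α)} (hf : f ∈ invWordSpan Z T a n) :
    foxDeriv b f ∈ wordSpan Z T n := by
  obtain ⟨p, hp, _, ⟨q, hq, rfl⟩, rfl⟩ := Submodule.mem_sup.1 hf
  rw [LinearMap.mulLeft_apply, map_add, foxDeriv_inv_of_mul, if_neg hab, sub_zero]
  exact add_mem (foxDeriv_mem hp b) (foxDeriv_mem hq b)

/-- The fundamental formula of Fox calculus. -/
theorem eq_augmentation_add_sum {T : Finset α} {n : ℕ} {f : MonoidAlgebra Z (FreeGroup α)}
    (hf : f ∈ wordSpan Z T n) :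
    f = algebraMap Z _ (augmentation f) +
      ∑ a ∈ T, (MonoidAlgebra.of Z _ (FreeGroup.of a) - 1) * foxDeriv a f := by
  classical
  induction hf using Submodule.span_induction with
  | zero => simp
  | add f g _ _ hf hg =>
    simp only [map_add, mul_add, Finset.sum_add_distrib]
    nth_rewrite 1 [hf, hg]
    abel
  | smul c f _ hf =>
    simp only [map_smul, mul_smul_comm, ← Finset.smul_sum]
    nth_rewrite 1 [hf]
    rw [smul_add, smul_eq_mul, map_mul, Algebra.smul_def]
  | mem _ h =>
    obtain ⟨g, hg, rfl⟩ := h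
    rw [augmentation_of, map_one]
    simp only [foxDeriv_of]
    change IsWord T n g at hg
    induction hg with
    | one => simp [foxCocycle_one, MonoidAlgebra.one_def]
    | @of_mul n g b hb hg ih =>
      simp only [foxCocycle_of_mul, mul_add, Finset.sum_add_distrib, mul_ite, mul_zero,
        Finset.sum_ite_eq', hb, if_true]
      rw [← add_assoc, ← ih, map_mul]
      noncomm_ring
    | @inv_of_mul n g b hb hg ih =>
      simp only [foxCocycle_inv_of_mul, mul_sub, Finset.sum_sub_distrib, mul_ite, mul_zero,
        Finset.sum_ite_eq', hb, if_true]
      rw [← add_sub_assoc, ← ih, sub_mul, ← mul_assoc, ← map_mul, mul_inv_cancel, map_one, map_mul]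
      noncomm_ring

/-! ### The Magnus expansion and its injectivity -/

/-- Iterated Fox derivatives. -/
def iteratedFoxDeriv : List α → MonoidAlgebra Z (FreeGroup α) →ₗ[Z] MonoidAlgebra Z (FreeGroup α)
  | [] => LinearMap.id
  | a :: m => iteratedFoxDeriv m ∘ₗ foxDeriv a

/-- The coefficient of the Magnus expansion of `f` at the monomial `m`. -/
def magnusCoeff (m : List α) (f : MonoidAlgebra Z (FreeGroup α)) : Z :=
  augmentation (iteratedFoxDeriv m f)

theorem magnusCoeff_nil (f : MonoidAlgebra Z (FreeGroup α)) :
    magnusCoeff [] f = augmentation f := rfl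

theorem magnusCoeff_cons (a : α) (m : List α) (f : MonoidAlgebra Z (FreeGroup α)) :
    magnusCoeff (a :: m) f = magnusCoeff m (foxDeriv a f) := rfl

theorem magnusCoeff_add (m : List α) (f g : MonoidAlgebra Z (FreeGroup α)) :
    magnusCoeff m (f + g) = magnusCoeff m f + magnusCoeff m g := by
  simp [magnusCoeff]

/-- Induction on word length. With `h = ∂ₐf`, the elements `∂ₐh + h` and `∂_b h` for `b ≠ a` are
shorter and have zero Magnus coefficients, so they vanish. The fundamental formula then reads `h =
-(a - 1)h`, that is `a h = 0`, and `a` is a unit. No assumption on `Z` is needed. -/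
theorem eq_zero_of_mem_wordSpan_of_magnusCoeff {T : Finset α} {n : ℕ}
    {f : MonoidAlgebra Z (FreeGroup α)} (hf : f ∈ wordSpan Z T n)
    (h : ∀ m, magnusCoeff m f = 0) : f = 0 := by
  induction n generalizing f with
  | zero =>
    have hf' : f = algebraMap Z _ (augmentation f) := by
      refine Submodule.span_le (p := LinearMap.eqLocus LinearMap.id
        (Algebra.linearMap Z _ ∘ₗ (augmentation (Z := Z) (α := α)).toLinearMap)) |>.2 ?_ hf
      rintro _ ⟨g, hg, rfl⟩
      cases hg
      change MonoidAlgebra.of Z _ 1 = algebraMap Z _ (augmentation (MonoidAlgebra.of Z _ 1))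
      rw [augmentation_of, map_one, map_one]
    rw [hf', ← magnusCoeff_nil, h, map_zero]
  | succ n ih =>
    have key (a : α) : foxDeriv a f = 0 := by
      have hmem := foxDeriv_mem_invWordSpan hf a
      have h1 : foxDeriv a (foxDeriv a f) + foxDeriv a f = 0 :=
        ih (foxDeriv_self_add_mem hmem) fun m => by
          rw [magnusCoeff_add, ← magnusCoeff_cons, ← magnusCoeff_cons, ← magnusCoeff_cons, h, h,
            add_zero]
      have h2 (b : α) (hb : b ≠ a) : foxDeriv b (foxDeriv a f) = 0 :=
        ih (foxDeriv_mem_of_ne hb hmem) fun m => by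
          rw [← magnusCoeff_cons, ← magnusCoeff_cons, h]
      have h3 : MonoidAlgebra.of Z _ (FreeGroup.of a) * foxDeriv a f = 0 := by
        classical
        have h4 := eq_augmentation_add_sum (wordSpan_mono (Finset.subset_insert a T) le_rfl
          (foxDeriv_mem hf a))
        rw [← magnusCoeff_nil, ← magnusCoeff_cons, h, map_zero, zero_add,
          Finset.sum_eq_single a (fun b _ hb => by rw [h2 b hb, mul_zero])
            (fun ha => absurd (Finset.mem_insert_self a T) ha),
          eq_neg_of_add_eq_zero_left h1] at h4
        rw [sub_mul, one_mul, mul_neg, sub_neg_eq_add] at h4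
        simpa using h4
      calc foxDeriv a f = MonoidAlgebra.of Z _ (FreeGroup.of a)⁻¹ *
            (MonoidAlgebra.of Z _ (FreeGroup.of a) * foxDeriv a f) := by
              rw [← mul_assoc, ← map_mul, inv_mul_cancel, map_one, one_mul]
        _ = 0 := by rw [h3, mul_zero]
    have h4 := eq_augmentation_add_sum hf
    rw [← magnusCoeff_nil, h, map_zero, zero_add] at h4
    rw [h4]
    exact Finset.sum_eq_zero fun a _ => by rw [key, mul_zero]

/-- The Magnus expansion is injective on the group algebra of a free group. -/
theorem exists_magnusCoeff_ne_zero {f : MonoidAlgebra Z (FreeGroup α)} (hf : f ≠ 0) :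
    ∃ m, magnusCoeff m f ≠ 0 := by
  by_contra! h
  obtain ⟨T, n, hT⟩ := exists_mem_wordSpan f
  exact hf (eq_zero_of_mem_wordSpan_of_magnusCoeff hT h)

end FreeGroupAlgebra

namespace PositiveFiltration

variable {Z R G α : Type*} [CommRing Z] [Ring R] [Algebra Z R]
  [AddGroup G] [LinearOrder G] [AddLeftMono G] [AddRightMono G]
  (v : PositiveFiltration Z R G)

/-! ### Symbols in the associated graded ring -/

/-- The homogeneous element `x + R_{> g}` of the associated graded ring, for `x ∈ R_{≥ g}`. -/
def symbol (g : G) : v.ge g →+ v.Gr := (DirectSum.of v.Piece g).comp (v.pieceMk g)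

theorem symbol_eq_zero_iff {g : G} (x : v.ge g) :
    v.symbol g x = 0 ↔ (g : WithTop G) < v (x : R) := by
  rw [← v.pieceMk_eq_zero_iff]
  exact map_eq_zero_iff (DirectSum.of v.Piece g) (DirectSum.of_injective g)

theorem symbol_mul {g h : G} (x : v.ge g) (y : v.ge h) :
    v.symbol g x * v.symbol h y = v.symbol (g + h) ⟨x * y, v.mem_ge.2 (v.mul_mem_ge x.2 y.2)⟩ :=
  DirectSum.of_mul_of _ _

theorem symbol_congr {g h : G} (hgh : g = h) {x : v.ge g} {y : v.ge h} (hxy : (x : R) = y) :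
    v.symbol g x = v.symbol h y := by
  subst hgh
  rw [Subtype.ext hxy]

theorem leadingForm_eq_symbol {x : R} {g : G} (hx : v x = g) :
    v.leadingForm x = v.symbol g ⟨x, v.mem_ge.2 hx.ge⟩ := by
  have h : v x ≠ ⊤ := hx ▸ WithTop.coe_ne_top
  rw [leadingForm, dif_neg h]
  refine v.symbol_congr ?_ rfl
  rw [← WithTop.coe_inj, WithTop.coe_untop, hx]

theorem leadingForm_eq_zero_iff {x : R} : v.leadingForm x = 0 ↔ x = 0 := by
  refine ⟨fun h => ?_, fun h => ?_⟩
  · by_contra hx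
    obtain ⟨g, hg⟩ := WithTop.ne_top_iff_exists.1 (mt (v.eq_top_iff' x).1 hx)
    rw [v.leadingForm_eq_symbol hg.symm, symbol_eq_zero_iff] at h
    exact h.ne hg
  · rw [leadingForm, dif_pos ((v.eq_top_iff' x).2 h)]

theorem grInclusion_symbol [FaithfulSMul Z R] {g : G} (a : v.restrict.ge g) :
    v.grInclusion (v.restrict.symbol g a) = v.symbol g (v.restrictGe g a) := by
  rw [grInclusion, symbol, AddMonoidHom.comp_apply, DirectSum.toSemiring_of]
  rfl

theorem sum_le_prod {r : α → R} {w : α → G} (hw : ∀ a, v (r a) = w a) (m : List α) :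
    ((m.map w).sum : WithTop G) ≤ v (m.map r).prod := by
  induction m with
  | nil => exact v.one_nonneg'
  | cons a m ih =>
    simp only [List.map_cons, List.sum_cons, List.prod_cons]
    exact v.mul_mem_ge (hw a).ge ih

theorem prod_leadingForm {r : α → R} {w : α → G} (hw : ∀ a, v (r a) = w a) (m : List α) :
    (m.map fun a => v.leadingForm (r a)).prod =
      v.symbol (m.map w).sum ⟨(m.map r).prod, v.mem_ge.2 (v.sum_le_prod hw m)⟩ := by
  induction m with
  | nil => rfl
  | cons a m ih =>
    rw [List.map_cons, List.prod_cons, ih, v.leadingForm_eq_symbol (hw a), symbol_mul]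
    exact v.symbol_congr rfl rfl

/-! ### Freeness of the leading forms and values of polynomials -/

variable [FaithfulSMul Z R]

/-- If the leading forms of the elements `r a` generate a free ring over `gr(Z)`, then their
monomials are linearly independent over `gr(Z)`. -/
theorem eq_zero_of_sum_leadingForm {X : Set R} (h1 : Set.InjOn v.leadingForm X)
    (h5 : GeneratesFreeRing v.grInclusion (v.leadingForm '' X)) {r : α → R} (hr : ∀ a, r a ∈ X)
    (hinj : Function.Injective r) (s : List α →₀ v.restrict.Gr)
    (hs : (s.sum fun m c => v.grInclusion c * (m.map fun a => v.leadingForm (r a)).prod) = 0) :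
    s = 0 := by
  obtain ⟨e, hS, hY⟩ := h5
  let y (a : α) : v.leadingForm '' X := ⟨v.leadingForm (r a), Set.mem_image_of_mem _ (hr a)⟩
  have hy : Function.Injective y := fun a b hab =>
    hinj (h1 (hr a) (hr b) (congrArg Subtype.val hab))
  let j (m : List α) : FreeMonoid (v.leadingForm '' X) := FreeMonoid.ofList (m.map y)
  have hj : Function.Injective j := FreeMonoid.ofList.injective.comp (List.map_injective_iff.2 hy)
  have hmon (m : List α) : (e (MonoidAlgebra.single (j m) 1) : v.Gr) =
      (m.map fun a => v.leadingForm (r a)).prod := by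
    induction m with
    | nil => exact (hS 1).trans (map_one _)
    | cons a m ih =>
      have h : (MonoidAlgebra.single (j (a :: m)) 1 : MonoidAlgebra v.restrict.Gr _) =
          MonoidAlgebra.single (FreeMonoid.of (y a)) 1 * MonoidAlgebra.single (j m) 1 := by
        rw [MonoidAlgebra.single_mul_single, mul_one]; rfl
      rw [h, map_mul, Subring.coe_mul, hY, ih, List.map_cons, List.prod_cons]
  have hterm (m : List α) (c : v.restrict.Gr) : (e (MonoidAlgebra.single (j m) c) : v.Gr) =
      v.grInclusion c * (m.map fun a => v.leadingForm (r a)).prod := by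
    have h : MonoidAlgebra.single (j m) c =
        MonoidAlgebra.single 1 c * MonoidAlgebra.single (j m) (1 : v.restrict.Gr) := by
      rw [MonoidAlgebra.single_mul_single, mul_one, one_mul]
    rw [h, map_mul, Subring.coe_mul, hS, hmon]
  have hsum : (∑ m ∈ s.support, MonoidAlgebra.single (j m) (s m)) = 0 := by
    apply e.injective
    apply Subtype.ext
    rw [map_sum, map_zero, AddSubmonoidClass.coe_finsetSum]
    simp only [hterm]
    exact hs
  refine Finsupp.mapDomain_injective hj ?_
  rw [Finsupp.mapDomain_zero]
  have := congrArg MonoidAlgebra.coeff hsum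
  simpa [Finsupp.mapDomain, Finsupp.sum] using this

/-- The value of a polynomial is at most the value of each of its terms. -/
theorem apply_sum_le {X : Set R} (h1 : Set.InjOn v.leadingForm X)
    (h5 : GeneratesFreeRing v.grInclusion (v.leadingForm '' X)) {r : α → R} (hr : ∀ a, r a ∈ X)
    (hinj : Function.Injective r) {w : α → G} (hw : ∀ a, v (r a) = w a) (p : List α →₀ Z)
    {m₀ : List α} (hm₀ : p m₀ ≠ 0) :
    v (p.sum fun m c => algebraMap Z R c * (m.map r).prod) ≤
      v (algebraMap Z R (p m₀)) + ((m₀.map w).sum : G) := by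
  classical
  -- Finite values of the coefficients; the choice `0` at vanishing coefficients is never used.
  have hex (m : List α) : ∃ g : G, p m ≠ 0 → v (algebraMap Z R (p m)) = g := by
    by_cases hm : p m = 0
    · exact ⟨0, fun h => absurd hm h⟩
    · obtain ⟨g, hg⟩ := WithTop.ne_top_iff_exists.1
        (mt (v.restrict.eq_top_iff' (p m)).1 hm)
      exact ⟨g, fun _ => hg.symm⟩
  choose z hz using hex
  obtain ⟨m₁, hm₁, hmin⟩ := p.support.exists_min_image (fun m => z m + (m.map w).sum)
    ⟨m₀, Finsupp.mem_support_iff.2 hm₀⟩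
  set δ := z m₁ + (m₁.map w).sum with hδ
  refine le_trans (b := (δ : WithTop G)) ?_ ?_
  swap
  · rw [hz m₀ hm₀, ← WithTop.coe_add, WithTop.coe_le_coe]
    exact hmin m₀ (Finsupp.mem_support_iff.2 hm₀)
  -- If the sum lies strictly above the least term value `δ`, its class in degree `δ` is zero. This
  -- is a linear relation over `gr(Z)` between monomials in the leading forms, nontrivial at `m₁`.
  by_contra! hlt
  have hmem (m : List α) :
      (δ : WithTop G) ≤ v (algebraMap Z R (p m) * (m.map r).prod) := by
    by_cases hm : p m = 0
    · rw [hm, map_zero, zero_mul, v.apply_zero]; exact le_top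
    · exact (WithTop.coe_le_coe.2 (hmin m (Finsupp.mem_support_iff.2 hm))).trans
        (v.mul_mem_ge (hz m hm).ge (v.sum_le_prod hw m))
  let s : List α →₀ v.restrict.Gr := Finsupp.onFinset p.support
    (fun m => if z m + (m.map w).sum = δ then v.restrict.leadingForm (p m) else 0)
    (fun m hm => by
      rw [Finsupp.mem_support_iff]
      rintro h
      rw [h, v.restrict.leadingForm_eq_zero_iff.2 rfl, ite_self] at hm
      exact hm rfl)
  have hs : s = 0 := by
    refine v.eq_zero_of_sum_leadingForm h1 h5 hr hinj s ?_
    rw [Finsupp.onFinset_sum _ (fun m => by rw [map_zero, zero_mul])]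
    have hterm (m : List α) (hm : m ∈ p.support) :
        v.grInclusion (if z m + (m.map w).sum = δ then v.restrict.leadingForm (p m) else 0) *
          (m.map fun a => v.leadingForm (r a)).prod =
        v.symbol δ ⟨algebraMap Z R (p m) * (m.map r).prod, v.mem_ge.2 (hmem m)⟩ := by
      have hm' := Finsupp.mem_support_iff.1 hm
      split_ifs with h
      · rw [v.restrict.leadingForm_eq_symbol (hz m hm'), grInclusion_symbol,
          v.prod_leadingForm hw, symbol_mul]
        exact v.symbol_congr h rfl
      · rw [map_zero, zero_mul, eq_comm, symbol_eq_zero_iff]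
        exact (WithTop.coe_lt_coe.2 (lt_of_le_of_ne (hmin m hm) (Ne.symm h))).trans_le
          (v.mul_mem_ge (hz m hm').ge (v.sum_le_prod hw m))
    rw [Finset.sum_congr rfl hterm, ← map_sum, symbol_eq_zero_iff, AddSubgroup.val_finsetSum]
    exact hlt
  have h := DFunLike.congr_fun hs m₁
  change (if z m₁ + (m₁.map w).sum = δ then v.restrict.leadingForm (p m₁) else 0) = 0 at h
  rw [if_pos rfl, leadingForm_eq_zero_iff] at h
  exact Finsupp.mem_support_iff.1 hm₁ h

end PositiveFiltration

namespace PositiveFiltration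

open FreeGroupAlgebra

variable {Z R G α : Type*} [CommRing Z] [Ring R] [Algebra Z R]
  [AddGroup G] [LinearOrder G] [AddLeftMono G] [AddRightMono G]
  (v : PositiveFiltration Z R G)

/-! ### Values of elements of a free group algebra -/

omit [AddLeftMono G] in
theorem le_apply_smul {g : WithTop G} {x : R} (c : Z) (hx : g ≤ v x) : g ≤ v (c • x) := by
  rw [Algebra.smul_def]
  exact hx.trans ((le_add_of_nonneg_left (v.nonneg' c)).trans (v.add_le_mul' _ _))

omit [AddRightMono G] in
theorem le_apply_sum {ι : Type*} {g : G} (T : Finset ι) {x : ι → R}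
    (hx : ∀ i ∈ T, (g : WithTop G) ≤ v (x i)) : (g : WithTop G) ≤ v (∑ i ∈ T, x i) :=
  sum_mem (S := v.ge g) hx

/-- The homomorphism from a free group algebra determined by a family of units. -/
def evalUnits (Z : Type*) {R : Type*} [CommRing Z] [Ring R] [Algebra Z R] (u : α → Rˣ) :
    MonoidAlgebra Z (FreeGroup α) →ₐ[Z] R :=
  MonoidAlgebra.lift Z R _ ((Units.coeHom R).comp (FreeGroup.lift u))

theorem evalUnits_of (u : α → Rˣ) (g : FreeGroup α) :
    evalUnits Z u (MonoidAlgebra.of Z _ g) = (FreeGroup.lift u g : Rˣ) := by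
  rw [evalUnits, MonoidAlgebra.lift_of]; rfl

variable {u : α → Rˣ} {T : Finset α} {γ : G}

/-- Each letter costs at most `γ`: inverses by assumption, and `u a = (u a - 1) + 1` because both
summands have nonnegative value. -/
theorem nsmul_neg_le_evalUnits (hγ : 0 ≤ γ) (hT : ∀ a ∈ T, (γ : WithTop G) ≤ v (u a - 1 : R))
    (hT' : ∀ a ∈ T, ((-γ : G) : WithTop G) ≤ v ((u a)⁻¹ : Rˣ)) {n : ℕ}
    {f : MonoidAlgebra Z (FreeGroup α)} (hf : f ∈ wordSpan Z T n) :
    ((n • (-γ) : G) : WithTop G) ≤ v (evalUnits Z u f) := by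
  induction hf using Submodule.span_induction with
  | zero => rw [map_zero, v.apply_zero]; exact le_top
  | add f g _ _ hf hg => rw [map_add]; exact (le_min hf hg).trans (v.min_le_add' _ _)
  | smul c f _ hf => rw [map_smul]; exact v.le_apply_smul c hf
  | mem _ h =>
    obtain ⟨g, hg, rfl⟩ := h
    rw [evalUnits_of]
    change IsWord T n g at hg
    induction hg with
    | one n =>
      rw [map_one]
      refine le_trans ?_ v.one_nonneg'
      exact WithTop.coe_le_coe.2 (nsmul_nonpos (neg_nonpos.2 hγ) n)
    | @of_mul n g b hb hg ih =>
      rw [map_mul, FreeGroup.lift_apply_of, Units.val_mul, succ_nsmul']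
      refine v.mul_mem_ge ?_ ih
      have h := v.min_le_add' (u b - 1 : R) 1
      rw [sub_add_cancel] at h
      have h0 : ((-γ : G) : WithTop G) ≤ 0 := WithTop.coe_le_coe.2 (neg_nonpos.2 hγ)
      refine le_trans (le_min ?_ (h0.trans v.one_nonneg')) h
      exact (h0.trans (WithTop.coe_le_coe.2 hγ)).trans (hT b hb)
    | @inv_of_mul n g b hb hg ih =>
      rw [map_mul, map_inv, FreeGroup.lift_apply_of, Units.val_mul, succ_nsmul']
      exact v.mul_mem_ge (hT' b hb) ih

/-- The image of an element of the free group algebra is approximated by the truncations of its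
Magnus expansion. -/
theorem exists_magnus_approx (hγ : 0 ≤ γ) (hT : ∀ a ∈ T, (γ : WithTop G) ≤ v (u a - 1 : R))
    (hT' : ∀ a ∈ T, ((-γ : G) : WithTop G) ≤ v ((u a)⁻¹ : Rˣ)) {n : ℕ} (N : ℕ)
    {f : MonoidAlgebra Z (FreeGroup α)} (hf : f ∈ wordSpan Z T n) :
    ∃ p : List α →₀ Z, (∀ m : List α, (∀ a ∈ m, a ∈ T) → m.length < N → p m = magnusCoeff m f) ∧
      ((N • γ + n • (-γ) : G) : WithTop G) ≤ v (evalUnits Z u f -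
        p.sum fun m c => algebraMap Z R c * (m.map fun a => (u a - 1 : R)).prod) := by
  classical
  induction N generalizing f with
  | zero =>
    refine ⟨0, fun m _ hm => absurd hm (Nat.not_lt_zero _), ?_⟩
    rw [Finsupp.sum_zero_index, sub_zero, zero_nsmul, zero_add]
    exact v.nsmul_neg_le_evalUnits hγ hT hT' hf
  | succ N ih =>
    choose p hp hv using fun a => ih (foxDeriv_mem hf a)
    have hcons (a : α) : Function.Injective (List.cons a) := List.cons_injective
    -- The fundamental formula for `f`, with each derivative replaced by its own truncation: `ε(f)`
    -- is the constant term and `p a` is shifted by the first letter `a`.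
    refine ⟨Finsupp.single [] (augmentation f) + ∑ a ∈ T, (p a).mapDomain (List.cons a), ?_, ?_⟩
    · intro m hm hN
      rw [Finsupp.add_apply, Finsupp.finsetSum_apply]
      cases m with
      | nil =>
        rw [Finsupp.single_eq_same, Finset.sum_eq_zero, add_zero, magnusCoeff_nil]
        exact fun a _ => Finsupp.mapDomain_of_notMem_range _ _ (by simp)
      | cons b m =>
        have hb := hm b List.mem_cons_self
        rw [Finsupp.single_eq_of_ne (by simp), zero_add, Finset.sum_eq_single_of_mem b hb,
          Finsupp.mapDomain_apply (hcons b), magnusCoeff_cons,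
          hp b m (fun a ha => hm a (List.mem_cons_of_mem _ ha)) (Nat.lt_of_succ_lt_succ hN)]
        exact fun a _ hab => Finsupp.mapDomain_of_notMem_range _ _ (by simp [hab])
    · have hsum : ((Finsupp.single [] (augmentation f) +
          ∑ a ∈ T, (p a).mapDomain (List.cons a)).sum
            fun m c => algebraMap Z R c * (m.map fun a => (u a - 1 : R)).prod) =
          algebraMap Z R (augmentation f) + ∑ a ∈ T, (u a - 1 : R) *
            (p a).sum fun m c => algebraMap Z R c * (m.map fun a => (u a - 1 : R)).prod := by
        rw [Finsupp.sum_add_index' (by simp) (by simp [add_mul]), Finsupp.sum_single_index (by simp),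
          ← Finsupp.sum_finsetSum_index (by simp) (by simp [add_mul])]
        congr 1
        · simp
        · refine Finset.sum_congr rfl fun a _ => ?_
          rw [Finsupp.sum_mapDomain_index (by simp) (by simp [add_mul]), Finsupp.mul_sum]
          refine Finsupp.sum_congr fun m _ => ?_
          -- Coefficients are central, so they move past the letter `u a - 1`.
          rw [List.map_cons, List.prod_cons, ← mul_assoc, Algebra.commutes, mul_assoc]
      have hev : evalUnits Z u f = algebraMap Z R (augmentation f) +
          ∑ a ∈ T, (u a - 1 : R) * evalUnits Z u (foxDeriv a f) := by
        conv_lhs => rw [eq_augmentation_add_sum hf]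
        rw [map_add, AlgHom.commutes, map_sum]
        congr 1
        refine Finset.sum_congr rfl fun a _ => ?_
        rw [map_mul, map_sub, map_one, evalUnits_of, FreeGroup.lift_apply_of]
      rw [hsum, hev, add_sub_add_left_eq_sub, ← Finset.sum_sub_distrib]
      refine v.le_apply_sum T fun a ha => ?_
      rw [← mul_sub, succ_nsmul', add_assoc]
      exact v.mul_mem_ge (hT a ha) (hv a)

/-- A nonzero element of a free group algebra has a nonzero image, provided that the values
involved are comparable with a single positive element `γ`. -/
theorem evalUnits_ne_zero [FaithfulSMul Z R] {X : Set R} (h1 : Set.InjOn v.leadingForm X)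
    (h5 : GeneratesFreeRing v.grInclusion (v.leadingForm '' X))
    (hX : ∀ a, (u a - 1 : R) ∈ X) (hinj : Function.Injective u) {w : α → G}
    (hw : ∀ a, v (u a - 1 : R) = w a)
    (hγ : ∀ T : Finset α, ∃ γ : G, 0 < γ ∧ (∀ a ∈ T, γ ≤ w a) ∧
      (∀ a ∈ T, ((-γ : G) : WithTop G) ≤ v ((u a)⁻¹ : Rˣ)) ∧ (∀ a, ∃ k : ℕ, w a ≤ k • γ) ∧
      ∀ z : Z, z ≠ 0 → ∃ k : ℕ, v (algebraMap Z R z) ≤ (k • γ : G))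
    {f : MonoidAlgebra Z (FreeGroup α)} (hf : f ≠ 0) : evalUnits Z u f ≠ 0 := by
  classical
  intro h0
  obtain ⟨m, hm⟩ := exists_magnusCoeff_ne_zero hf
  obtain ⟨S, n, hS⟩ := exists_mem_wordSpan f
  -- The letters of `m` are included so that the truncation has the true Magnus coefficient at `m`.
  obtain ⟨γ, hpos, hle, hinv, harch, hZ⟩ := hγ (S ∪ m.toFinset)
  obtain ⟨k, hk⟩ : ∃ k : ℕ, (m.map w).sum ≤ k • γ := by
    generalize m = m
    induction m with
    | nil => exact ⟨0, by simp⟩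
    | cons a m ih =>
      obtain ⟨k, hk⟩ := ih
      obtain ⟨l, hl⟩ := harch a
      refine ⟨l + k, ?_⟩
      rw [List.map_cons, List.sum_cons, add_nsmul]
      exact add_le_add hl hk
  obtain ⟨l, hl⟩ := hZ _ hm
  -- In this truncation order, `n` offsets the loss `n • (-γ)`, `m.length + 1` puts `m` within the
  -- truncation, and what is left strictly exceeds the upper bound `l + k`.
  obtain ⟨p, hp, hv⟩ := v.exists_magnus_approx hpos.le
    (fun a ha => (hw a).symm ▸ WithTop.coe_le_coe.2 (hle a ha)) hinv
    (l + k + m.length + 1 + n) (wordSpan_mono Finset.subset_union_left le_rfl hS)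
  have hpm := hp m (fun a ha => Finset.mem_union_right _ (List.mem_toFinset.2 ha)) (by omega)
  rw [h0, zero_sub] at hv
  have hlow := hv.trans (v.le_apply_neg _)
  rw [neg_neg] at hlow
  have hup := v.apply_sum_le h1 h5 hX
    (fun a b hab => hinj (Units.ext (sub_left_injective hab))) hw p (hpm.symm ▸ hm)
  rw [hpm] at hup
  have := (hlow.trans hup).trans (add_le_add hl (WithTop.coe_le_coe.2 hk))
  rw [← WithTop.coe_add, WithTop.coe_le_coe, ← add_nsmul, add_nsmul _ _ n, add_assoc, neg_nsmul,
    add_neg_cancel, add_zero] at this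
  exact (nsmul_lt_nsmul_left hpos (by omega : l + k < l + k + m.length + 1)).not_ge this

end PositiveFiltration

/-! ### From injectivity to the theorem -/

/-- A family of units without algebraic relations other than those of the free group generates a
free group algebra. -/
theorem generatesFreeGroupAlgebra_of_injective {Z R : Type*} [CommRing Z] [Ring R] [Algebra Z R]
    {Y : Set R} (u : Y → Rˣ) (hu : ∀ y, (u y : R) = y)
    (hinj : Function.Injective (PositiveFiltration.evalUnits Z u)) :
    GeneratesFreeGroupAlgebra Z Y := by
  have hof (y : Y) : PositiveFiltration.evalUnits Z u (MonoidAlgebra.of Z _ (FreeGroup.of y)) = y := by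
    rw [PositiveFiltration.evalUnits_of, FreeGroup.lift_apply_of, hu]
  have hrange : (PositiveFiltration.evalUnits Z u).range =
      Algebra.adjoin Z (Y ∪ {a : R | ∃ u : Rˣ, (u : R) ∈ Y ∧ a = (u⁻¹ : Rˣ)}) := by
    apply le_antisymm
    · rintro _ ⟨f, rfl⟩
      change PositiveFiltration.evalUnits Z u f ∈ _
      induction f using MonoidAlgebra.induction_on with
      | of g =>
        rw [PositiveFiltration.evalUnits_of]
        induction g using FreeGroup.induction_on with
        | C1 => rw [map_one]; exact one_mem _
        | of y =>
          rw [FreeGroup.lift_apply_of, hu]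
          exact Algebra.subset_adjoin (Or.inl y.2)
        | inv_of y _ =>
          rw [map_inv, FreeGroup.lift_apply_of]
          exact Algebra.subset_adjoin (Or.inr ⟨u y, (hu y).symm ▸ y.2, rfl⟩)
        | mul g h hg hh => rw [map_mul, Units.val_mul]; exact mul_mem hg hh
      | add f g hf hg => rw [map_add]; exact add_mem hf hg
      | smul c f hf => rw [map_smul]; exact Subalgebra.smul_mem _ hf c
    · refine Algebra.adjoin_le ?_
      rintro _ (hy | ⟨t, ht, rfl⟩)
      · exact ⟨_, hof ⟨_, hy⟩⟩
      · refine ⟨MonoidAlgebra.of Z _ (FreeGroup.of ⟨_, ht⟩)⁻¹, ?_⟩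
        change PositiveFiltration.evalUnits Z u _ = _
        rw [PositiveFiltration.evalUnits_of, map_inv, FreeGroup.lift_apply_of]
        exact congrArg (fun s : Rˣ => ((s⁻¹ : Rˣ) : R)) (Units.ext (hu ⟨_, ht⟩))
  refine ⟨fun y hy => ⟨u ⟨y, hy⟩, hu _⟩,
    (AlgEquiv.ofInjective _ hinj).trans (Subalgebra.equivOfEq _ _ hrange), hof⟩

theorem theorem3p5 {Z R G : Type*} [CommRing Z] [Ring R] [Algebra Z R] [FaithfulSMul Z R]
    [AddGroup G] [LinearOrder G] [AddLeftMono G] [AddRightMono G]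
    (v : PositiveFiltration Z R G) (X : Set R)
    (h1 : Set.InjOn v.leadingForm X)
    (h2 : ∀ x ∈ X, 0 < v x)
    (h3 : ∀ x ∈ X, ∀ y ∈ X, ValueArchEquiv (v x) (v y))
    (h4 : ¬ ∃ z : Z, ∃ x ∈ X, ValueInfSmall (v x) (v (algebraMap Z R z)))
    (h5 : GeneratesFreeRing v.grInclusion (v.leadingForm '' X))
    (h6 : ∀ x ∈ X, ∃ u : Rˣ, (u : R) = 1 + x ∧ ValueInfSmall (v ↑(u⁻¹)) (v x)) :
    GeneratesFreeGroupAlgebra Z ((fun x => 1 + x) '' X) := by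
  classical
  have hsub (y : (fun x => 1 + x) '' X) : ((y : R) - 1) ∈ X := by
    obtain ⟨_, x, hx, rfl⟩ := y
    simpa using hx
  choose u hu hsmall using fun y => h6 _ (hsub y)
  have hu' (y) : (u y : R) = y := by rw [hu, add_sub_cancel]
  have hX (y) : (u y - 1 : R) ∈ X := by rw [hu']; exact hsub y
  -- Comparing an element with itself already says that its value is finite.
  choose w _ hw _ _ using fun y => h3 _ (hX y) _ (hX y)
  have hwpos (y) : 0 < w y := by
    have := h2 _ (hX y)
    rw [hw y] at this
    exact WithTop.coe_lt_coe.1 this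
  have harch (a b) : ∃ k : ℕ, 0 < k ∧ w a < k • w b := by
    obtain ⟨g, h, hg, hh, k, -, hk, -, hlt, -⟩ := h3 _ (hX a) _ (hX b)
    rw [hw, WithTop.coe_inj] at hg hh
    subst hg hh
    rw [abs_of_pos (hwpos a), abs_of_pos (hwpos b)] at hlt
    exact ⟨k, hk, hlt⟩
  refine generatesFreeGroupAlgebra_of_injective u hu' ((injective_iff_map_eq_zero _).2 fun f hf => ?_)
  by_contra hf0
  -- With no generators there is no `γ` to choose, but every `f` is then a scalar and `Z` embeds in
  -- `R`.
  rcases isEmpty_or_nonempty ((fun x => 1 + x) '' X) with hempty | ⟨⟨y₀⟩⟩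
  · obtain ⟨T, n, hT⟩ := FreeGroupAlgebra.exists_mem_wordSpan f
    have h := FreeGroupAlgebra.eq_augmentation_add_sum hT
    rw [Finset.eq_empty_of_isEmpty T, Finset.sum_empty, add_zero] at h
    rw [h, AlgHom.commutes, FaithfulSMul.algebraMap_eq_zero_iff] at hf
    rw [hf, map_zero] at h
    exact hf0 h
  refine v.evalUnits_ne_zero h1 h5 hX
    (fun a b hab => Subtype.ext ((hu' a).symm.trans ((congrArg Units.val hab).trans (hu' b)))) hw
    (fun T => ?_) hf0 hf
  -- Adding `y₀` provides a minimum even when `T` is empty.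
  obtain ⟨b, -, hb⟩ := (insert y₀ T).exists_min_image w ⟨y₀, Finset.mem_insert_self _ _⟩
  refine ⟨w b, hwpos b, fun a ha => hb a (Finset.mem_insert_of_mem ha), fun a _ => ?_, fun a => ?_,
    fun z hz => ?_⟩
  · obtain ⟨g, h, hg, hh, hgh⟩ := hsmall a
    rw [← hu', hw, WithTop.coe_inj] at hh
    subst hh
    -- For `g` the value of the inverse of `u a`: `k|g| < w a < k • w b` gives `|g| < w b`, hence
    -- `-w b ≤ g`.
    obtain ⟨k, hk, hlt⟩ := harch a b
    have := (hgh k hk).trans (by rwa [abs_of_pos (hwpos a)])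
    rw [hg, WithTop.coe_le_coe]
    exact (neg_le_neg_iff.2 (lt_of_nsmul_lt_nsmul_right k this).le).trans (neg_le.2 (neg_le_abs g))
  · obtain ⟨k, -, hk⟩ := harch a b
    exact ⟨k, hk.le⟩
  · obtain ⟨g, hg⟩ := WithTop.ne_top_iff_exists.1 (mt (v.restrict.eq_top_iff' z).1 hz)
    -- A value above every multiple of `w b` would be infinitely large relative to it, against
    -- condition 4.
    by_contra! hlt
    refine h4 ⟨z, _, hX b, w b, g, hw b, hg.symm, fun k _ => ?_⟩
    have := hlt k
    change _ < v.restrict z at this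
    rw [← hg, WithTop.coe_lt_coe] at this
    rw [abs_of_pos (hwpos b)]
    exact this.trans_le (le_abs_self g)

end
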